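/- All graphs $G$ below are finite and simple; $d_v$ denotes the degree of $v$ in $G$, and $K_{a,b}$ is the complete bipartite graph with parts of sizes $a$ and $b$. For graphs $F,H$ let $\hom(F,H)$ be the number of graph homomorphisms from $F$ to $H$. If $H$ is a finite weighted graph, i.e. a finite set $\Omega$ with vertex weights $\mu\colon\Omega\to\mathbb{R}_{\ge 0}$ and a symmetric edge-weight function $w\colon\Omega\times\Omega\to\mathbb{R}_{\ge 0}$ (loops allowed), let \[ \hom(F,H)=\sum_{x\colon V(F)\to\Omega}\ \prod_{v\in V(F)}\mu(x_v)\prod_{uv\in E(F)}w(x_u,x_v). \] Let $G$ be a graph containing a triangle. Then: (i) there is a finite simple graph $H$ with \[ \hom(G,H)>\prod_{uv\in E(G)}\hom(K_{d_u,d_v},H)^{1/(d_ud_v)}; \] (ii) there is $\varepsilon_0>0$, which may depend on $G$, such that for every $0<\varepsilon<\varepsilon_0$ the same strict inequality holds for the weighted graph $H=H_\varepsilon$ on two vertices, each of vertex weight $1/2$, with a loop of weight $1+2\varepsilon$ at each vertex and an edge of weight $1$ between the two vertices. -/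

import Mathlib

open scoped NNReal

/-- The number `hom(F, H)` of graph homomorphisms from `F` to `H`. -/
noncomputable def homCount {V W : Type*} (F : SimpleGraph V) (H : SimpleGraph W) : ℕ :=
  Nat.card (F →g H)

/-- A finite weighted graph on the vertex set `Ω`: nonnegative vertex weights and a symmetric
nonnegative edge-weight function. Loops are allowed, since `edgeWeight x x` is arbitrary. -/
structure FinWeightedGraph (Ω : Type*) where
  vertexWeight : Ω → ℝ≥0
  edgeWeight : Ω → Ω → ℝ≥0
  symm : ∀ x y, edgeWeight x y = edgeWeight y x

/-- The edge-weight function on unordered pairs. -/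
def FinWeightedGraph.pairWeight {Ω : Type*} (H : FinWeightedGraph Ω) : Sym2 Ω → ℝ≥0 :=
  Sym2.lift ⟨H.edgeWeight, H.symm⟩

open Classical in
/-- The weighted homomorphism number (partition function)
`∑_{x : V → Ω} ∏_v vertexWeight (x v) ∏_{uv ∈ E(F)} edgeWeight (x u) (x v)`. -/
noncomputable def weightedHom {V Ω : Type*} [Fintype V] [Fintype Ω]
    (F : SimpleGraph V) (H : FinWeightedGraph Ω) : ℝ :=
  ∑ x : V → Ω, (∏ v, (H.vertexWeight (x v) : ℝ)) *
    ∏ e ∈ F.edgeFinset, (H.pairWeight (e.map x) : ℝ)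

/-- The weighted graph on two vertices of weight `1/2`, with a loop of weight `1 + 2ε` at each
vertex and an edge of weight `1` between the two vertices. -/
noncomputable def twoVertexGraph (ε : ℝ≥0) : FinWeightedGraph (Fin 2) where
  vertexWeight _ := 1 / 2
  edgeWeight x y := if x = y then 1 + 2 * ε else 1
  symm x y := by simp only [eq_comm]

/-- The complete bipartite graph `K_{a,b}`. -/
abbrev biclique (a b : ℕ) : SimpleGraph (Fin a ⊕ Fin b) :=
  completeBipartiteGraph (Fin a) (Fin b)

/-- `K_{a,b}` is isomorphic to `K_{b,a}`. -/
def bicliqueSwap (a b : ℕ) : biclique a b ≃g biclique b a where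
  toEquiv := Equiv.sumComm _ _
  map_rel_iff' := by
    intro x y
    cases x <;> cases y <;> simp [biclique]

theorem homCount_congr {V V' W : Type*} {F : SimpleGraph V} {F' : SimpleGraph V'}
    (f : F ≃g F') (H : SimpleGraph W) : homCount F H = homCount F' H :=
  Nat.card_congr
    { toFun := fun g => g.comp f.symm.toHom
      invFun := fun g => g.comp f.toHom
      left_inv := fun g => by ext; simp
      right_inv := fun g => by ext; simp }

theorem weightedHom_congr {V V' Ω : Type*} [Fintype V] [Fintype V'] [Fintype Ω]
    {F : SimpleGraph V} {F' : SimpleGraph V'} (f : F ≃g F') (H : FinWeightedGraph Ω) :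
    weightedHom F H = weightedHom F' H := by
  classical
  have hs : ∀ v, f.toEquiv.symm (f v) = v := f.toEquiv.symm_apply_apply
  have ha : ∀ u v, F'.Adj (f u) (f v) ↔ F.Adj u v := fun u v => f.map_adj_iff
  have hb : ∀ u v, F.Adj (f.symm u) (f.symm v) ↔ F'.Adj u v := fun u v => f.symm.map_adj_iff
  unfold weightedHom
  refine Fintype.sum_equiv (Equiv.arrowCongr f.toEquiv (Equiv.refl Ω)) _ _ fun x => ?_
  congr 1
  · exact Fintype.prod_equiv f.toEquiv _ _ fun v => by simpa using congrArg (fun w => H.vertexWeight (x w)) (hs v).symm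
  · refine Finset.prod_bij (fun e _ => e.map f) ?_ ?_ ?_ ?_
    · intro e he
      induction e with | _ u v => simpa [ha] using he
    · intro e _ e' _ h
      exact Sym2.map.injective f.injective h
    · intro e he
      refine ⟨e.map f.symm, ?_, ?_⟩
      · induction e with | _ u v => simpa [hb] using he
      · induction e with | _ u v => simp
    · intro e _
      induction e with | _ u v =>
        have h1 := hs u
        have h2 := hs v
        simp only [Sym2.map_mk, Equiv.arrowCongr_apply, Equiv.coe_refl, Function.comp_apply, id_eq]
        rw [h1, h2]

open Classical in
/-- `∏_{uv ∈ E(G)} hom(K_{d_u,d_v}, H)^{1/(d_u d_v)}`, where `d_v` is the degree of `v` in `G`. -/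
noncomputable def bicliqueProd {V W : Type*} [Fintype V]
    (G : SimpleGraph V) (H : SimpleGraph W) : ℝ :=
  ∏ e ∈ G.edgeFinset, Sym2.lift
    ⟨fun u v => (homCount (biclique (G.degree u) (G.degree v)) H : ℝ) ^
        (1 / ((G.degree u : ℝ) * (G.degree v : ℝ))),
      fun u v => by beta_reduce; rw [homCount_congr (bicliqueSwap _ _) H, mul_comm]⟩ e

open Classical in
/-- `∏_{uv ∈ E(G)} hom(K_{d_u,d_v}, H)^{1/(d_u d_v)}` for a finite weighted graph `H`. -/
noncomputable def weightedBicliqueProd {V Ω : Type*} [Fintype V] [Fintype Ω]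
    (G : SimpleGraph V) (H : FinWeightedGraph Ω) : ℝ :=
  ∏ e ∈ G.edgeFinset, Sym2.lift
    ⟨fun u v => weightedHom (biclique (G.degree u) (G.degree v)) H ^
        (1 / ((G.degree u : ℝ) * (G.degree v : ℝ))),
      fun u v => by beta_reduce; rw [weightedHom_congr (bicliqueSwap _ _) H, mul_comm]⟩ e

/-! Write the edge weights as `1 + σ * b` with `σ = 1` or `σ = -1` and `b` a small perturbation with
constant row mean `β`. Expanding the product over edges turns the density of a graph with edge set
`E` into the sum over `A ⊆ E` of `σ ^ #A` times the density of `A` in `b`. If `A` is a forest,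
stripping leaves gives exactly `β ^ #A`, and if every `A` did so the total would be `(1 + σ * β) ^
#E`. The deviation comes from cycles: a triangle contributes `σ ^ 3 * (κ - β ^ 3)`, at least `δ`,
and every other edge set contributes at most `η` in absolute value (`abs_edgeDensity_sub_le`).

Bicliques contain no triangle, so the root attached to each edge of `G` is at most `(1 + σ * β) * (1
+ O(η))`, and the product over the edges exceeds `(1 + σ * β) ^ #E` by only `O(η)`. A graph with a
triangle gains at least `δ - O(η)`. The inequality follows once `δ` is large compared with `η`
(`exists_forall_prod_lt_edgeDensity`).

For (ii), `b` is `2 * ε` on loops and `σ = 1`: then `δ = ε ^ 3` and `η = O(ε ^ 4)`. For (i), `σ =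
-1` and `b` is the adjacency of a large cube: it has no triangles, so `δ = β ^ 3`, and few
four-cycles, so `η = O(β ^ 3 / d)`. The resulting target has loops; they are removed by giving
vertices one of `q` colours and requiring distinct colours along edges, which is asymptotically
harmless as `q` grows. -/

open Finset

/-! ### Edge sets without leaves -/

/-- A loopless edge set in which no vertex has exactly one edge and which is not a triangle
contains a triangle together with a further edge, or a path with four edges, or a four-cycle. -/
theorem exists_subset_of_leafless {V : Type*} [DecidableEq V] {A : Finset (Sym2 V)} (hne : A.Nonempty)
    (hloop : ∀ e ∈ A, ¬ e.IsDiag)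
    (hleaf : ∀ u v, s(u, v) ∈ A → ∃ w, w ≠ u ∧ s(v, w) ∈ A)
    (htri : ∀ u v w : V, u ≠ v → v ≠ w → w ≠ u → A ≠ {s(u, v), s(v, w), s(w, u)}) :
    (∃ u v w, u ≠ v ∧ v ≠ w ∧ w ≠ u ∧ ∃ e, e ∉ ({s(u, v), s(v, w), s(w, u)} : Finset (Sym2 V)) ∧
      insert e {s(u, v), s(v, w), s(w, u)} ⊆ A) ∨
    (∃ r t u v w, [r, t, u, v, w].Nodup ∧ {s(r, t), s(t, u), s(u, v), s(v, w)} ⊆ A) ∨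
    (∃ t u v w, [t, u, v, w].Nodup ∧ {s(t, u), s(u, v), s(v, w), s(w, t)} ⊆ A) := by
  have hl : ∀ u v, s(u, v) ∈ A → u ≠ v := fun u v h => by simpa using hloop _ h
  obtain ⟨e, he⟩ := hne
  induction e with | _ a₀ a₁
  -- Follow a walk `a₀ a₁ a₂ a₃ a₄` that never backtracks. Its only possible coincidences are `a₃ =
  -- a₀`, `a₄ = a₁` and `a₄ = a₀`.
  obtain ⟨a₂, h20, h12⟩ := hleaf _ _ he
  obtain ⟨a₃, h31, h23⟩ := hleaf _ _ h12
  have n01 := hl _ _ he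
  have n12 := hl _ _ h12
  have n23 := hl _ _ h23
  by_cases h30 : a₃ = a₀
  · subst h30
    left
    have hsub : {s(a₃, a₁), s(a₁, a₂), s(a₂, a₃)} ⊆ A := by
      simp [Finset.insert_subset_iff, he, h12, h23]
    obtain ⟨e, heA, he'⟩ := Finset.exists_of_ssubset
      (Finset.ssubset_iff_subset_ne.2 ⟨hsub, (htri a₃ a₁ a₂ n01 n12 n23).symm⟩)
    exact ⟨a₃, a₁, a₂, n01, n12, n23, e, he', Finset.insert_subset heA hsub⟩
  obtain ⟨a₄, h42, h34⟩ := hleaf _ _ h23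
  have n34 := hl _ _ h34
  by_cases h41 : a₄ = a₁
  · subst h41
    left
    refine ⟨a₄, a₂, a₃, n12, n23, n34, s(a₀, a₄), by simp; grind, ?_⟩
    simp [Finset.insert_subset_iff, he, h12, h23, h34]
  right
  by_cases h40 : a₄ = a₀
  · subst h40
    right
    refine ⟨a₄, a₁, a₂, a₃, by simp; grind, ?_⟩
    simp [Finset.insert_subset_iff, he, h12, h23, h34]
  left
  refine ⟨a₀, a₁, a₂, a₃, a₄, by simp; grind, ?_⟩
  simp [Finset.insert_subset_iff, he, h12, h23, h34]

/-! ### Densities of edge sets in a kernel -/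

section Density

variable {V Ω : Type*} [Fintype V] [DecidableEq V] [Fintype Ω]

/-- The homomorphism density of the edge set `A` in the kernel `b`: the average of
`∏ e ∈ A, b (e.map x)` over all maps `x : V → Ω`. -/
noncomputable def edgeDensity (A : Finset (Sym2 V)) (b : Sym2 Ω → ℝ) : ℝ :=
  (∑ x : V → Ω, ∏ e ∈ A, b (e.map x)) / (Fintype.card Ω : ℝ) ^ Fintype.card V

/-- Resampling one coordinate does not change the sum over all maps, up to normalization. -/
theorem card_mul_sum_eq_sum_update (v : V) (f : (V → Ω) → ℝ) :
    (Fintype.card Ω : ℝ) * ∑ x, f x = ∑ x : V → Ω, ∑ ω, f (Function.update x v ω) := by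
  classical
  rw [← Fintype.sum_prod_type']
  -- A pair `(x, ω)` updates to `y` when `ω = y v` and `x` agrees with `y` off `v`; the value `x v`
  -- remains free.
  have h : ∀ y : V → Ω, ∑ p : (V → Ω) × Ω, (if Function.update p.1 v p.2 = y then f y else 0)
      = Fintype.card Ω * f y := by
    intro y
    rw [Finset.sum_ite, Finset.sum_const_zero, add_zero, Finset.sum_const, nsmul_eq_mul]
    congr 2
    rw [← Finset.card_univ]
    refine Finset.card_bij (fun p _ => p.1 v) (by simp) ?_ ?_
    · rintro ⟨x, ω⟩ hx ⟨x', ω'⟩ hx' h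
      simp only [mem_filter, mem_univ, true_and] at hx hx' h
      have h1 : ω = ω' := by
        have := congrFun (hx.trans hx'.symm) v
        simpa using this
      refine Prod.ext ?_ h1
      funext w
      by_cases hw : w = v
      · subst hw; exact h
      · have := congrFun (hx.trans hx'.symm) w
        simpa [hw] using this
    · intro ω _
      exact ⟨(Function.update y v ω, y v), by simp, by simp⟩
  rw [Finset.mul_sum, ← Finset.sum_congr rfl fun y _ => h y, Finset.sum_comm]
  exact Finset.sum_congr rfl fun p _ => by simp

/-- The kernel `b` takes values in `[0, M]` with `M ≤ 1`, every row has mean `β`, the density of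
triangles through every point is `κ` and the density of closed walks of length four through every
point is at most `ζ`. -/
structure IsCycleKernel (b : Sym2 Ω → ℝ) (β M κ ζ : ℝ) : Prop where
  nonneg : ∀ e, 0 ≤ b e
  le : ∀ e, b e ≤ M
  le_one : M ≤ 1
  row : ∀ x, ∑ y, b s(x, y) = Fintype.card Ω * β
  triangle : ∀ x, ∑ y, ∑ z, b s(x, y) * b s(y, z) * b s(z, x) = (Fintype.card Ω : ℝ) ^ 2 * κ
  square : ∀ x, ∑ y, ∑ z, ∑ w, b s(x, y) * b s(y, z) * b s(z, w) * b s(w, x) ≤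
    (Fintype.card Ω : ℝ) ^ 3 * ζ

variable [Nonempty Ω] {b : Sym2 Ω → ℝ} {β M κ ζ : ℝ}

theorem edgeDensity_empty (b : Sym2 Ω → ℝ) : edgeDensity (∅ : Finset (Sym2 V)) b = 1 := by
  simp [edgeDensity]

theorem edgeDensity_nonneg (hb : ∀ e, 0 ≤ b e) (A : Finset (Sym2 V)) : 0 ≤ edgeDensity A b :=
  div_nonneg (Finset.sum_nonneg fun _ _ => Finset.prod_nonneg fun _ _ => hb _) (by positivity)

theorem edgeDensity_anti (h0 : ∀ e, 0 ≤ b e) (h1 : ∀ e, b e ≤ 1) {A A' : Finset (Sym2 V)}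
    (h : A' ⊆ A) : edgeDensity A b ≤ edgeDensity A' b := by
  refine div_le_div_of_nonneg_right (Finset.sum_le_sum fun x _ => ?_) (by positivity)
  rw [← Finset.prod_sdiff h]
  exact mul_le_of_le_one_left (Finset.prod_nonneg fun _ _ => h0 _)
    (Finset.prod_le_one (fun _ _ => h0 _) fun _ _ => h1 _)

theorem edgeDensity_insert_le (h0 : ∀ e, 0 ≤ b e) (h1 : ∀ e, b e ≤ M) {A : Finset (Sym2 V)}
    {e : Sym2 V} (he : e ∉ A) : edgeDensity (insert e A) b ≤ M * edgeDensity A b := by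
  unfold edgeDensity
  rw [← mul_div_assoc, Finset.mul_sum]
  refine div_le_div_of_nonneg_right (Finset.sum_le_sum fun x _ => ?_) (by positivity)
  rw [Finset.prod_insert he]
  exact mul_le_mul_of_nonneg_right (h1 _) (Finset.prod_nonneg fun _ _ => h0 _)

/-- Removing a pendant edge divides the density by the row mean. -/
theorem edgeDensity_of_leaf (hrow : ∀ x, ∑ y, b s(x, y) = Fintype.card Ω * β)
    {A : Finset (Sym2 V)} {u v : V} (huv : u ≠ v) (hA : s(u, v) ∈ A)
    (hleaf : ∀ e ∈ A, v ∈ e → e = s(u, v)) :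
    edgeDensity A b = β * edgeDensity (A.erase s(u, v)) b := by
  have hn : (Fintype.card Ω : ℝ) ≠ 0 := by simp
  unfold edgeDensity
  rw [← mul_div_assoc]
  congr 1
  apply mul_left_cancel₀ hn
  rw [card_mul_sum_eq_sum_update v, ← mul_assoc, Finset.mul_sum]
  refine Finset.sum_congr rfl fun x _ => ?_
  rw [← hrow (x u), Finset.sum_mul]
  refine Finset.sum_congr rfl fun ω _ => ?_
  rw [← Finset.mul_prod_erase A _ hA]
  congr 1
  · simp [huv]
  · refine Finset.prod_congr rfl fun e he => ?_
    congr 1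
    refine Sym2.map_congr fun w hw => Function.update_of_ne ?_ _ _
    rintro rfl
    exact (Finset.mem_erase.1 he).1 (hleaf e (Finset.mem_erase.1 he).2 hw)

theorem edgeDensity_triangle (hb : IsCycleKernel b β M κ ζ) {u v w : V} (huv : u ≠ v)
    (hvw : v ≠ w) (hwu : w ≠ u) : edgeDensity {s(u, v), s(v, w), s(w, u)} b = κ := by
  have hn : (Fintype.card Ω : ℝ) ≠ 0 := by simp
  have hp : ∀ x : V → Ω, ∏ e ∈ ({s(u, v), s(v, w), s(w, u)} : Finset (Sym2 V)), b (e.map x) =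
      b s(x u, x v) * b s(x v, x w) * b s(x w, x u) := by
    intro x
    rw [Finset.prod_insert (by simp; grind), Finset.prod_insert (by simp; grind),
      Finset.prod_singleton]
    simp [mul_assoc]
  unfold edgeDensity
  rw [div_eq_iff (by positivity)]
  apply mul_left_cancel₀ (pow_ne_zero 2 hn)
  simp only [hp]
  rw [pow_two, mul_assoc, card_mul_sum_eq_sum_update w, card_mul_sum_eq_sum_update v]
  simp only [Function.update_self, Function.update_of_ne huv, Function.update_of_ne hvw,
    Function.update_of_ne hwu.symm, hb.triangle]
  simp
  ring

theorem edgeDensity_square_le (hb : IsCycleKernel b β M κ ζ) {t u v w : V} (htu : t ≠ u)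
    (htv : t ≠ v) (htw : t ≠ w) (huv : u ≠ v) (huw : u ≠ w) (hvw : v ≠ w) :
    edgeDensity {s(t, u), s(u, v), s(v, w), s(w, t)} b ≤ ζ := by
  have hn : (0 : ℝ) < Fintype.card Ω := by exact_mod_cast Fintype.card_pos
  have hp : ∀ x : V → Ω, ∏ e ∈ ({s(t, u), s(u, v), s(v, w), s(w, t)} : Finset (Sym2 V)),
      b (e.map x) = b s(x t, x u) * b s(x u, x v) * b s(x v, x w) * b s(x w, x t) := by
    intro x
    rw [Finset.prod_insert (by simp; grind), Finset.prod_insert (by simp; grind),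
      Finset.prod_insert (by simp; grind), Finset.prod_singleton]
    simp [mul_assoc]
  unfold edgeDensity
  rw [div_le_iff₀ (by positivity)]
  refine le_of_mul_le_mul_left ?_ (pow_pos hn 3)
  simp only [hp]
  rw [pow_succ, pow_two, mul_assoc, mul_assoc, card_mul_sum_eq_sum_update w,
    card_mul_sum_eq_sum_update v, card_mul_sum_eq_sum_update u]
  simp only [Function.update_self, Function.update_of_ne htu, Function.update_of_ne htv,
    Function.update_of_ne htw, Function.update_of_ne huv, Function.update_of_ne huw,
    Function.update_of_ne hvw]
  refine (Finset.sum_le_sum fun x _ => hb.square (x t)).trans_eq ?_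
  simp
  ring

theorem edgeDensity_path (hrow : ∀ x, ∑ y, b s(x, y) = Fintype.card Ω * β) {r t u v w : V}
    (hrt : r ≠ t) (hru : r ≠ u) (hrv : r ≠ v) (hrw : r ≠ w) (htu : t ≠ u) (htv : t ≠ v)
    (htw : t ≠ w) (huv : u ≠ v) (huw : u ≠ w) (hvw : v ≠ w) :
    edgeDensity {s(r, t), s(t, u), s(u, v), s(v, w)} b = β ^ 4 := by
  have hn : (Fintype.card Ω : ℝ) ≠ 0 := by simp
  have hp : ∀ x : V → Ω, ∏ e ∈ ({s(r, t), s(t, u), s(u, v), s(v, w)} : Finset (Sym2 V)),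
      b (e.map x) = b s(x r, x t) * (b s(x t, x u) * (b s(x u, x v) * b s(x v, x w))) := by
    intro x
    rw [Finset.prod_insert (by simp; grind), Finset.prod_insert (by simp; grind),
      Finset.prod_insert (by simp; grind), Finset.prod_singleton]
    simp
  unfold edgeDensity
  rw [div_eq_iff (by positivity)]
  apply mul_left_cancel₀ (pow_ne_zero 4 hn)
  simp only [hp]
  rw [pow_succ, pow_succ, pow_two, mul_assoc, mul_assoc, mul_assoc, card_mul_sum_eq_sum_update w,
    card_mul_sum_eq_sum_update v, card_mul_sum_eq_sum_update u, card_mul_sum_eq_sum_update t]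
  simp only [Function.update_self, Function.update_of_ne hrt, Function.update_of_ne hru,
    Function.update_of_ne hrv, Function.update_of_ne hrw, Function.update_of_ne htu,
    Function.update_of_ne htv, Function.update_of_ne htw, Function.update_of_ne huv,
    Function.update_of_ne huw, Function.update_of_ne hvw, ← Finset.mul_sum, hrow,
    ← Finset.sum_mul]
  simp
  ring

/-- The density of a loopless edge set that is not a triangle is close to that of a forest. -/
theorem abs_edgeDensity_sub_le (hb : IsCycleKernel b β M κ ζ) {η : ℝ} (hβ0 : 0 ≤ β) (hβ1 : β ≤ 1)
    (hη1 : β * |κ - β ^ 3| ≤ η) (hη2 : β ^ 4 + M * κ ≤ η) (hη3 : 2 * β ^ 4 ≤ η)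
    (hη4 : β ^ 4 + ζ ≤ η) (A : Finset (Sym2 V)) (hloop : ∀ e ∈ A, ¬ e.IsDiag)
    (htri : ∀ u v w : V, u ≠ v → v ≠ w → w ≠ u → A ≠ {s(u, v), s(v, w), s(w, u)}) :
    |edgeDensity A b - β ^ #A| ≤ η := by
  have hη : 0 ≤ η := le_trans (by positivity) hη3
  have hb1 : ∀ e, b e ≤ 1 := fun e => (hb.le e).trans hb.le_one
  induction hk : #A generalizing A with
  | zero =>
    rw [Finset.card_eq_zero.1 hk, edgeDensity_empty]
    simpa using hη
  | succ k ih =>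
    by_cases hleaf : ∀ u v, s(u, v) ∈ A → ∃ w, w ≠ u ∧ s(v, w) ∈ A
    -- Without leaves there are at least four edges, so the density and `β ^ #A` are both small and
    -- no cancellation between them is needed.
    · have key : edgeDensity A b ≤ max (M * κ) (max (β ^ 4) ζ) ∧ 4 ≤ #A := by
        rcases exists_subset_of_leafless (Finset.card_pos.1 (by omega)) hloop hleaf htri with
          ⟨u, v, w, huv, hvw, hwu, e, he, hsub⟩ | ⟨r, t, u, v, w, hnd, hsub⟩ |
          ⟨t, u, v, w, hnd, hsub⟩
        · refine ⟨le_max_of_le_left ?_, ?_⟩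
          · rw [← edgeDensity_triangle hb huv hvw hwu]
            exact (edgeDensity_anti hb.nonneg hb1 hsub).trans
              (edgeDensity_insert_le hb.nonneg hb.le he)
          · refine le_trans (le_of_eq ?_) (Finset.card_le_card hsub)
            rw [Finset.card_insert_of_notMem he, Finset.card_insert_of_notMem (by simp; grind),
              Finset.card_insert_of_notMem (by simp; grind), Finset.card_singleton]
        · simp only [List.nodup_cons, List.mem_cons, not_or, List.not_mem_nil] at hnd
          refine ⟨le_max_of_le_right (le_max_of_le_left ?_), ?_⟩
          · refine (edgeDensity_anti hb.nonneg hb1 hsub).trans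
              (edgeDensity_path hb.row ?_ ?_ ?_ ?_ ?_ ?_ ?_ ?_ ?_ ?_).le <;> tauto
          · refine le_trans (le_of_eq ?_) (Finset.card_le_card hsub)
            rw [Finset.card_insert_of_notMem (by simp; grind),
              Finset.card_insert_of_notMem (by simp; grind),
              Finset.card_insert_of_notMem (by simp; grind), Finset.card_singleton]
        · simp only [List.nodup_cons, List.mem_cons, not_or, List.not_mem_nil] at hnd
          refine ⟨le_max_of_le_right (le_max_of_le_right ?_), ?_⟩
          · refine (edgeDensity_anti hb.nonneg hb1 hsub).trans
              (edgeDensity_square_le hb ?_ ?_ ?_ ?_ ?_ ?_) <;> tauto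
          · refine le_trans (le_of_eq ?_) (Finset.card_le_card hsub)
            rw [Finset.card_insert_of_notMem (by simp; grind),
              Finset.card_insert_of_notMem (by simp; grind),
              Finset.card_insert_of_notMem (by simp; grind), Finset.card_singleton]
      rw [← hk]
      have h4 : β ^ #A ≤ β ^ 4 := pow_le_pow_of_le_one hβ0 hβ1 key.2
      have h0 : 0 ≤ β ^ #A := by positivity
      have hd := edgeDensity_nonneg hb.nonneg A
      have h40 : 0 ≤ β ^ 4 := by positivity
      have hmax : max (M * κ) (max (β ^ 4) ζ) ≤ η :=
        max_le (by linarith) (max_le (by linarith) (by linarith))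
      rw [abs_le]
      constructor <;> linarith [key.1]
    · push Not at hleaf
      obtain ⟨u, v, huv, hv⟩ := hleaf
      have hne : u ≠ v := by simpa using hloop _ huv
      have hcard : #(A.erase s(u, v)) = k := by rw [Finset.card_erase_of_mem huv, hk]; rfl
      have hl : ∀ e ∈ A, v ∈ e → e = s(u, v) := by
        intro e he hve
        obtain ⟨w, rfl⟩ := hve
        by_cases hw : w = u
        · rw [hw, Sym2.eq_swap]
        · exact absurd he (hv w hw)
      rw [edgeDensity_of_leaf hb.row hne huv hl, pow_succ', ← mul_sub, abs_mul, abs_of_nonneg hβ0]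
      by_cases ht : ∀ u' v' w' : V, u' ≠ v' → v' ≠ w' → w' ≠ u' →
          A.erase s(u, v) ≠ {s(u', v'), s(v', w'), s(w', u')}
      · have := ih _ (fun e he => hloop e (Finset.mem_of_mem_erase he)) ht hcard
        exact (mul_le_of_le_one_left (abs_nonneg _) hβ1).trans this
      -- Stripping the leaf left a triangle, which the induction hypothesis excludes; its deviation
      -- is now damped by the factor `β`.
      · push Not at ht
        obtain ⟨u', v', w', h1, h2, h3, h⟩ := ht
        have hk3 : k = 3 := by
          rw [← hcard, h, Finset.card_insert_of_notMem (by simp; grind),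
            Finset.card_insert_of_notMem (by simp; grind), Finset.card_singleton]
        rw [h, edgeDensity_triangle hb h1 h2 h3, hk3]
        exact hη1

end Density

/-! ### Expansion over edge subsets -/

section Expansion

variable {V Ω : Type*} [Fintype V] [DecidableEq V] [Fintype Ω]
  {b : Sym2 Ω → ℝ} {β M κ ζ : ℝ}

theorem edgeDensity_one_add (E : Finset (Sym2 V)) (b : Sym2 Ω → ℝ) (σ : ℝ) :
    edgeDensity E (fun e => 1 + σ * b e) = ∑ A ∈ E.powerset, σ ^ #A * edgeDensity A b := by
  unfold edgeDensity
  simp only [Finset.prod_one_add, Finset.prod_mul_distrib, Finset.prod_const]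
  rw [Finset.sum_comm, Finset.sum_div]
  exact Finset.sum_congr rfl fun A _ => by rw [← Finset.mul_sum, mul_div_assoc]

theorem edgeDensity_one_add_sub (E : Finset (Sym2 V)) (b : Sym2 Ω → ℝ) (σ β : ℝ) :
    edgeDensity E (fun e => 1 + σ * b e) - (1 + σ * β) ^ #E =
      ∑ A ∈ E.powerset, σ ^ #A * (edgeDensity A b - β ^ #A) := by
  have h : (1 + σ * β) ^ #E = ∑ A ∈ E.powerset, σ ^ #A * β ^ #A := by
    rw [← Finset.prod_const, Finset.prod_one_add]
    simp [mul_pow]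
  rw [edgeDensity_one_add, h, ← Finset.sum_sub_distrib]
  exact Finset.sum_congr rfl fun A _ => by ring

theorem edgeDensity_one_add_le [Nonempty Ω] (hb : IsCycleKernel b β M κ ζ) {η σ : ℝ} (hσ : |σ| = 1)
    (hβ0 : 0 ≤ β) (hβ1 : β ≤ 1) (hη1 : β * |κ - β ^ 3| ≤ η) (hη2 : β ^ 4 + M * κ ≤ η)
    (hη3 : 2 * β ^ 4 ≤ η) (hη4 : β ^ 4 + ζ ≤ η) (E : Finset (Sym2 V))
    (hloop : ∀ e ∈ E, ¬ e.IsDiag)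
    (htri : ∀ u v w : V, u ≠ v → v ≠ w → w ≠ u → ¬ {s(u, v), s(v, w), s(w, u)} ⊆ E) :
    edgeDensity E (fun e => 1 + σ * b e) ≤ (1 + σ * β) ^ #E + 2 ^ #E * η := by
  rw [← sub_le_iff_le_add', edgeDensity_one_add_sub]
  have : ∑ A ∈ E.powerset, σ ^ #A * (edgeDensity A b - β ^ #A) ≤ ∑ A ∈ E.powerset, η := by
    refine Finset.sum_le_sum fun A hA => (le_abs_self _).trans ?_
    rw [abs_mul, abs_pow, hσ, one_pow, one_mul]
    rw [Finset.mem_powerset] at hA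
    refine abs_edgeDensity_sub_le hb hβ0 hβ1 hη1 hη2 hη3 hη4 A (fun e he => hloop e (hA he)) ?_
    rintro u v w h1 h2 h3 rfl
    exact htri u v w h1 h2 h3 hA
  simpa using this

theorem le_edgeDensity_one_add [Nonempty Ω] (hb : IsCycleKernel b β M κ ζ) {η σ δ : ℝ} (hσ : |σ| = 1)
    (hβ0 : 0 ≤ β) (hβ1 : β ≤ 1) (hη1 : β * |κ - β ^ 3| ≤ η) (hη2 : β ^ 4 + M * κ ≤ η)
    (hη3 : 2 * β ^ 4 ≤ η) (hη4 : β ^ 4 + ζ ≤ η) (hδ0 : 0 ≤ δ) (hδ : δ ≤ σ ^ 3 * (κ - β ^ 3))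
    (E : Finset (Sym2 V)) (hloop : ∀ e ∈ E, ¬ e.IsDiag) {u v w : V} (huv : u ≠ v) (hvw : v ≠ w)
    (hwu : w ≠ u) (hE : {s(u, v), s(v, w), s(w, u)} ⊆ E) :
    (1 + σ * β) ^ #E + δ - 2 ^ #E * η ≤ edgeDensity E (fun e => 1 + σ * b e) := by
  have hη : 0 ≤ η := le_trans (by positivity) hη3
  have hc : ∀ {x y z : V}, x ≠ y → y ≠ z → z ≠ x →
      #({s(x, y), s(y, z), s(z, x)} : Finset (Sym2 V)) = 3 := by
    intro x y z h1 h2 h3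
    rw [Finset.card_insert_of_notMem (by simp; grind),
      Finset.card_insert_of_notMem (by simp; grind), Finset.card_singleton]
  set T : Finset (Sym2 V) := {s(u, v), s(v, w), s(w, u)} with hT
  -- Every triangle contributes at least `δ ≥ 0`, so it suffices to keep the gain of the single
  -- triangle `T`.
  have key : ∑ A ∈ E.powerset, ((if A = T then δ else 0) - η) ≤
      ∑ A ∈ E.powerset, σ ^ #A * (edgeDensity A b - β ^ #A) := by
    refine Finset.sum_le_sum fun A hA => ?_
    rw [Finset.mem_powerset] at hA
    by_cases htri : ∃ x y z : V, x ≠ y ∧ y ≠ z ∧ z ≠ x ∧ A = {s(x, y), s(y, z), s(z, x)}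
    · obtain ⟨x, y, z, h1, h2, h3, rfl⟩ := htri
      rw [hc h1 h2 h3, edgeDensity_triangle hb h1 h2 h3]
      split_ifs <;> linarith
    · push Not at htri
      have hAT : A ≠ T := htri u v w huv hvw hwu
      have := abs_edgeDensity_sub_le hb hβ0 hβ1 hη1 hη2 hη3 hη4 A (fun e he => hloop e (hA he)) htri
      have h2 : |σ ^ #A * (edgeDensity A b - β ^ #A)| ≤ η := by
        rwa [abs_mul, abs_pow, hσ, one_pow, one_mul]
      rw [if_neg hAT]
      linarith [(abs_le.1 h2).1]
  rw [← edgeDensity_one_add_sub, Finset.sum_sub_distrib, Finset.sum_ite_eq',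
    if_pos (Finset.mem_powerset.2 hE)] at key
  simp only [Finset.sum_const, Finset.card_powerset, nsmul_eq_mul, Nat.cast_pow,
    Nat.cast_ofNat] at key
  linarith

end Expansion

/-! ### Comparison with bicliques -/

theorem one_add_pow_le_one_add_two_pow_mul {x : ℝ} (h0 : 0 ≤ x) (h1 : x ≤ 1) (m : ℕ) :
    (1 + x) ^ m ≤ 1 + 2 ^ m * x := by
  suffices h : (1 + x) ^ m ≤ 1 + (2 ^ m - 1) * x by linarith
  induction m with
  | zero => simp
  | succ m ih =>
    have h2 : (1 : ℝ) ≤ 2 ^ m := one_le_pow₀ (by norm_num)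
    calc (1 + x) ^ (m + 1) = (1 + x) ^ m * (1 + x) := pow_succ _ _
      _ ≤ (1 + (2 ^ m - 1) * x) * (1 + x) := by gcongr
      _ = 1 + x + (2 ^ m - 1) * x + ((2 ^ m - 1) * x) * x := by ring
      _ ≤ 1 + x + (2 ^ m - 1) * x + ((2 ^ m - 1) * x) * 1 := by
        gcongr
      _ = 1 + (2 ^ (m + 1) - 1) * x := by ring

/-- Since `p ≥ 1 / 2`, `2 ^ a ≤ p ^ a * 4 ^ a`, so the additive error becomes a relative one. The
bound `L` makes it uniform over all bicliques that occur. -/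
theorem rpow_one_div_le_of_le_pow_add {p T η : ℝ} {a L : ℕ} (ha : 0 < a) (haL : a ≤ L)
    (hp : 1 / 2 ≤ p) (hη : 0 ≤ η) (hT0 : 0 ≤ T) (hT : T ≤ p ^ a + 2 ^ a * η) :
    T ^ (1 / (a : ℝ)) ≤ p * (1 + 4 ^ L * η) := by
  have hp0 : 0 < p := by linarith
  have h0 : 0 ≤ p * (1 + 4 ^ L * η) := by positivity
  have h : T ≤ (p * (1 + 4 ^ L * η)) ^ a := by
    refine hT.trans ?_
    rw [mul_pow]
    have h1 : 1 + 4 ^ a * η ≤ (1 + 4 ^ L * η) ^ a := by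
      calc 1 + 4 ^ a * η ≤ 1 + 4 ^ L * η := by gcongr; norm_num
        _ ≤ _ := le_self_pow₀ (by have : 0 ≤ (4 : ℝ) ^ L * η := by positivity
                                  linarith) ha.ne'
    refine le_trans ?_ (mul_le_mul_of_nonneg_left h1 (by positivity))
    have h2 : (2 : ℝ) ^ a ≤ p ^ a * 4 ^ a := by
      rw [← mul_pow]
      gcongr
      linarith
    have := mul_le_mul_of_nonneg_right h2 hη
    linarith
  calc T ^ (1 / (a : ℝ)) ≤ ((p * (1 + 4 ^ L * η)) ^ a) ^ (1 / (a : ℝ)) := by gcongr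
    _ = _ := by rw [one_div, Real.pow_rpow_inv_natCast h0 ha.ne']

theorem prod_lt_pow_add_sub {ι : Type*} {E : Finset ι} {R : ι → ℝ} {p δ η : ℝ} {L : ℕ}
    (hp : 1 / 2 ≤ p) (hp' : p ≤ 2) (hη : 0 ≤ η) (hδ : δ ≤ 1)
    (hη' : (2 ^ #E + 4 ^ #E * 4 ^ L) * η < δ) (hR0 : ∀ e ∈ E, 0 ≤ R e)
    (hR : ∀ e ∈ E, R e ≤ p * (1 + 4 ^ L * η)) :
    ∏ e ∈ E, R e < p ^ #E + δ - 2 ^ #E * η := by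
  have hp0 : 0 < p := by linarith
  have hx0 : 0 ≤ 4 ^ L * η := by positivity
  have hx1 : 4 ^ L * η ≤ 1 := by
    have h1 : (1 : ℝ) ≤ 4 ^ #E := one_le_pow₀ (by norm_num)
    have h2 : 0 ≤ (2 : ℝ) ^ #E * η := by positivity
    nlinarith [mul_nonneg (sub_nonneg.2 h1) hx0]
  have h1 := one_add_pow_le_one_add_two_pow_mul hx0 hx1 #E
  have h2 : p ^ #E ≤ 2 ^ #E := by gcongr
  have h3 : (4 : ℝ) ^ #E = 2 ^ #E * 2 ^ #E := by rw [← mul_pow]; norm_num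
  calc ∏ e ∈ E, R e ≤ ∏ e ∈ E, (p * (1 + 4 ^ L * η)) := Finset.prod_le_prod hR0 hR
    _ = p ^ #E * (1 + 4 ^ L * η) ^ #E := by rw [Finset.prod_const, mul_pow]
    _ ≤ p ^ #E * (1 + 2 ^ #E * (4 ^ L * η)) := by gcongr
    _ = p ^ #E + p ^ #E * (2 ^ #E * (4 ^ L * η)) := by ring
    _ ≤ p ^ #E + 2 ^ #E * (2 ^ #E * (4 ^ L * η)) := by gcongr
    _ < _ := by rw [h3] at hη'; linarith

open Classical in
/-- If a cycle kernel has triangle density sufficiently far from that of a three-edge forest, in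
comparison with its other cycle densities, then the densities in `1 + σ b` violate the biclique
inequality for a graph with a triangle. -/
theorem exists_forall_prod_lt_edgeDensity {V : Type*} [Fintype V] (G : SimpleGraph V)
    (hG : ¬ G.CliqueFree 3) :
    ∃ C : ℝ, 0 < C ∧ ∀ (Ω : Type) [Fintype Ω] [Nonempty Ω] (b : Sym2 Ω → ℝ)
      (β M κ ζ σ δ η : ℝ), IsCycleKernel b β M κ ζ → |σ| = 1 → 0 ≤ β → β ≤ 1 / 2 →
      β * |κ - β ^ 3| ≤ η → β ^ 4 + M * κ ≤ η → 2 * β ^ 4 ≤ η → β ^ 4 + ζ ≤ η → 0 ≤ δ → δ ≤ 1 →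
      δ ≤ σ ^ 3 * (κ - β ^ 3) → C * η < δ →
      ∀ R : Sym2 V → ℝ, (∀ e, 0 ≤ R e) → (∀ u v, G.Adj u v → R s(u, v) ≤
        edgeDensity (biclique (G.degree u) (G.degree v)).edgeFinset (fun e => 1 + σ * b e) ^
          (1 / ((G.degree u : ℝ) * (G.degree v : ℝ)))) →
      ∏ e ∈ G.edgeFinset, R e < edgeDensity G.edgeFinset (fun e => 1 + σ * b e) := by
  set L := Fintype.card V * Fintype.card V
  refine ⟨2 ^ #G.edgeFinset + 4 ^ #G.edgeFinset * 4 ^ L, by positivity, ?_⟩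
  intro Ω _ _ b β M κ ζ σ δ η hb hσ hβ0 hβ1 hη1 hη2 hη3 hη4 hδ0 hδ1 hδ hC R hR0 hR
  have hη : 0 ≤ η := le_trans (by positivity) hη3
  have hσβ : |σ * β| ≤ 1 / 2 := by rwa [abs_mul, hσ, one_mul, abs_of_nonneg hβ0]
  rw [abs_le] at hσβ
  have hβ1' : β ≤ 1 := by linarith
  have hb1 : ∀ e, b e ≤ 1 := fun e => (hb.le e).trans hb.le_one
  have hpos : ∀ e, 0 ≤ 1 + σ * b e := by
    intro e
    have : |σ * b e| ≤ 1 := by rw [abs_mul, hσ, one_mul, abs_of_nonneg (hb.nonneg e)]; exact hb1 e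
    linarith [(abs_le.1 this).1]
  obtain ⟨s, hs⟩ := _root_.not_forall_not.1 hG
  obtain ⟨u, v, w, huv, huw, hvw, -⟩ := SimpleGraph.is3Clique_iff.1 hs
  have hGE := le_edgeDensity_one_add hb hσ hβ0 hβ1' hη1 hη2 hη3 hη4 hδ0 hδ G.edgeFinset
    (fun e he => G.not_isDiag_of_mem_edgeSet (SimpleGraph.mem_edgeFinset.1 he)) huv.ne hvw.ne huw.ne'
    (by simp [Finset.insert_subset_iff, huv, hvw, huw.symm])
  refine lt_of_lt_of_le (prod_lt_pow_add_sub (L := L) (by linarith) (by linarith) hη hδ1 hC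
    (fun e _ => hR0 e) ?_) hGE
  intro e he
  induction e with | _ u v
  have huv : G.Adj u v := by simpa using he
  refine (hR u v huv).trans ?_
  have hu : 0 < G.degree u := (G.degree_pos_iff_exists_adj u).2 ⟨v, huv⟩
  have hv : 0 < G.degree v := (G.degree_pos_iff_exists_adj v).2 ⟨u, huv.symm⟩
  rw [← Nat.cast_mul]
  refine rpow_one_div_le_of_le_pow_add (Nat.mul_pos hu hv)
    (Nat.mul_le_mul (G.degree_lt_card_verts u).le (G.degree_lt_card_verts v).le) (by linarith) hη
    (edgeDensity_nonneg hpos _) ?_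
  have hcard : #(biclique (G.degree u) (G.degree v)).edgeFinset = G.degree u * G.degree v := by
    have h := SimpleGraph.encard_edgeSet_completeBipartiteGraph (W₁ := Fin (G.degree u))
      (W₂ := Fin (G.degree v))
    rw [← SimpleGraph.coe_edgeFinset, Set.encard_coe_eq_coe_finsetCard,
      ENat.card_eq_coe_fintype_card, ENat.card_eq_coe_fintype_card, Fintype.card_fin,
      Fintype.card_fin] at h
    exact_mod_cast h
  rw [← hcard]
  refine edgeDensity_one_add_le hb hσ hβ0 hβ1' hη1 hη2 hη3 hη4 _
    (fun e he => SimpleGraph.not_isDiag_of_mem_edgeSet _ (SimpleGraph.mem_edgeFinset.1 he)) ?_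
  -- Two of three vertices lie on the same side of the biclique.
  rintro x y z - - - h
  simp only [Finset.insert_subset_iff, Finset.singleton_subset_iff, SimpleGraph.mem_edgeFinset,
    SimpleGraph.mem_edgeSet] at h
  rcases x with x | x <;> rcases y with y | y <;> rcases z with z | z <;> simp at h

/-! ### The two-vertex weighted graph -/

theorem isCycleKernel_loops {ε : ℝ} (h0 : 0 ≤ ε) (h1 : ε ≤ 1 / 2) :
    IsCycleKernel (fun e : Sym2 (Fin 2) => if e.IsDiag then 2 * ε else 0) ε (2 * ε) (2 * ε ^ 3)
      (2 * ε ^ 4) where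
  nonneg e := by split_ifs <;> linarith
  le e := by split_ifs <;> linarith
  le_one := by linarith
  row x := by fin_cases x <;> simp
  triangle x := by fin_cases x <;> simp <;> ring
  square x := by fin_cases x <;> simp <;> exact le_of_eq (by ring)

theorem weightedHom_twoVertexGraph {V : Type*} [Fintype V] [DecidableEq V] (F : SimpleGraph V)
    [Fintype F.edgeSet] (ε : ℝ≥0) :
    weightedHom F (twoVertexGraph ε) = edgeDensity F.edgeFinset
      (fun e : Sym2 (Fin 2) => 1 + 1 * (if e.IsDiag then 2 * (ε : ℝ) else 0)) := by
  have h : ∀ e : Sym2 (Fin 2), ((twoVertexGraph ε).pairWeight e : ℝ) =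
      1 + 1 * (if e.IsDiag then 2 * (ε : ℝ) else 0) := by
    intro e
    induction e with | _ x y
    by_cases hxy : x = y <;> simp [FinWeightedGraph.pairWeight, twoVertexGraph, hxy]
  unfold weightedHom edgeDensity
  simp only [h]
  simp only [twoVertexGraph, Finset.prod_const, Finset.card_univ, Fintype.card_fin]
  rw [← Finset.mul_sum]
  rw [mul_comm, div_eq_mul_inv]
  congr 1
  · congr!
  · simp

theorem weightedHom_nonneg {V Ω : Type*} [Fintype V] [Fintype Ω] (F : SimpleGraph V)
    (H : FinWeightedGraph Ω) : 0 ≤ weightedHom F H :=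
  Finset.sum_nonneg fun _ _ => by positivity

theorem exists_forall_weightedBicliqueProd_lt {V : Type*} [Fintype V] (G : SimpleGraph V)
    (hG : ¬ G.CliqueFree 3) : ∃ ε₀ : ℝ≥0, 0 < ε₀ ∧ ∀ ε : ℝ≥0, 0 < ε → ε < ε₀ →
      weightedBicliqueProd G (twoVertexGraph ε) < weightedHom G (twoVertexGraph ε) := by
  classical
  obtain ⟨C, hC, h⟩ := exists_forall_prod_lt_edgeDensity G hG
  refine ⟨Real.toNNReal (min (1 / 2) (1 / (20 * C))), Real.toNNReal_pos.2 (by positivity), ?_⟩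
  intro ε hε0 hε1
  have hε : (0 : ℝ) < ε := hε0
  have hε1' : (ε : ℝ) < min (1 / 2) (1 / (20 * C)) := Real.lt_toNNReal_iff_coe_lt.1 hε1
  obtain ⟨hε2, hε3⟩ := lt_min_iff.1 hε1'
  rw [lt_div_iff₀ (by positivity)] at hε3
  have hpow : (0 : ℝ) < ε ^ 3 := by positivity
  have h4 : (0 : ℝ) < ε ^ 4 := by positivity
  rw [weightedHom_twoVertexGraph]
  -- Here `κ - β ^ 3 = ε ^ 3`, while all error terms are at most `5 * ε ^ 4`; the coefficient `20`
  -- leaves slack and matches the choice of `ε₀`.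
  refine h (Fin 2) _ ε (2 * ε) (2 * ε ^ 3) (2 * ε ^ 4) 1 (ε ^ 3) (20 * ε ^ 4)
    (isCycleKernel_loops hε.le hε2.le) (by simp) hε.le hε2.le ?_ (by nlinarith) (by nlinarith)
    (by nlinarith) hpow.le (pow_le_one₀ hε.le (by linarith)) (by linarith) (by nlinarith) _ ?_ ?_
  · rw [show (2 * (ε : ℝ) ^ 3 - ε ^ 3) = ε ^ 3 by ring, abs_of_pos hpow]
    nlinarith
  · intro e
    induction e with | _ u v
    exact Real.rpow_nonneg (weightedHom_nonneg _ _) _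
  · intro u v _
    change weightedHom (biclique (G.degree u) (G.degree v)) (twoVertexGraph ε) ^
      (1 / ((G.degree u : ℝ) * (G.degree v : ℝ))) ≤ _
    rw [weightedHom_twoVertexGraph]

/-! ### The cube as a kernel -/

/-- The graph of the `d`-dimensional cube. -/
def cubeGraph (d : ℕ) : SimpleGraph (Fin d → ZMod 2) where
  Adj x y := ∃ i, y = x + Pi.single i 1
  symm := ⟨by
    rintro x y ⟨i, rfl⟩
    exact ⟨i, by
      funext j
      simp [add_assoc, CharTwo.add_self_eq_zero]⟩⟩
  loopless := ⟨by
    rintro x ⟨i, hi⟩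
    simpa using congrFun hi i⟩

open Classical in
/-- The adjacency indicator of a graph, on unordered pairs. -/
noncomputable def adjIndicator {W : Type*} (H : SimpleGraph W) (e : Sym2 W) : ℝ :=
  if e ∈ H.edgeSet then 1 else 0

theorem sum_adjIndicator_cubeGraph_mul {d : ℕ} (x : Fin d → ZMod 2) (g : (Fin d → ZMod 2) → ℝ) :
    ∑ y, adjIndicator (cubeGraph d) s(x, y) * g y = ∑ i, g (x + Pi.single i 1) := by
  classical
  have hinj : Function.Injective fun i : Fin d => x + (Pi.single i 1 : Fin d → ZMod 2) := by
    intro i j h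
    by_contra hij
    simpa [hij] using congrFun (add_left_cancel h) i
  rw [← Finset.sum_image (f := g) (s := univ) fun i _ j _ h => hinj h,
    ← Finset.sum_filter_add_sum_filter_not univ (fun y => (cubeGraph d).Adj x y)]
  rw [Finset.sum_eq_zero (s := univ.filter fun y => ¬ (cubeGraph d).Adj x y), add_zero]
  · refine Finset.sum_congr ?_ ?_
    · ext y
      rw [Finset.mem_filter_univ, Finset.mem_image]
      simp [cubeGraph, eq_comm]
    · intro y hy
      simp only [mem_image, mem_univ, true_and] at hy
      obtain ⟨i, rfl⟩ := hy
      have h : (cubeGraph d).Adj x (x + Pi.single i 1) := ⟨i, rfl⟩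
      simp [adjIndicator, h]
  · intro y hy
    simp [adjIndicator, (Finset.mem_filter.1 hy).2]

theorem not_cubeGraph_triangle {d : ℕ} {x y z : Fin d → ZMod 2} (h1 : (cubeGraph d).Adj x y)
    (h2 : (cubeGraph d).Adj y z) (h3 : (cubeGraph d).Adj z x) : False := by
  obtain ⟨i, rfl⟩ := h1
  obtain ⟨j, rfl⟩ := h2
  obtain ⟨k, hk⟩ := h3
  rw [add_assoc, add_assoc, left_eq_add] at hk
  -- The coordinate sum of three unit vectors is odd, so they cannot cancel.
  have := congrArg (fun f : Fin d → ZMod 2 => ∑ m, f m) hk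
  simp only [Pi.add_apply, Finset.sum_add_distrib, Fintype.sum_pi_single', Pi.zero_apply,
    Finset.sum_const_zero] at this
  exact absurd this (by decide)

/-- In a closed walk of four steps the directions cancel in pairs, so two of the first three agree.
Summing over directions leaves at most `3 * d ^ 2` such walks, against `d ^ 3` choices of three
steps. -/
theorem adjIndicator_cubeGraph_add_le {d : ℕ} (x : Fin d → ZMod 2) (i j k : Fin d) :
    adjIndicator (cubeGraph d) s(x + Pi.single i 1 + Pi.single j 1 + Pi.single k 1, x) ≤
      (if i = j then 1 else 0) + (if i = k then 1 else 0) + (if j = k then 1 else 0) := by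
  by_cases h : (cubeGraph d).Adj (x + Pi.single i 1 + Pi.single j 1 + Pi.single k 1) x
  · have hor : i = j ∨ i = k ∨ j = k := by
      by_contra! hne
      obtain ⟨hij, hik, hjk⟩ := hne
      obtain ⟨l, hl⟩ := h
      rw [add_assoc, add_assoc, add_assoc, left_eq_add] at hl
      have hi := congrFun hl i
      have hj := congrFun hl j
      by_cases hli : i = l
      · subst hli
        simp [hij.symm, hjk] at hj
      · simp [hij, hik, hli] at hi
    have h0 : ∀ p : Prop, ∀ [Decidable p], (0 : ℝ) ≤ if p then 1 else 0 := by
      intro p _; split_ifs <;> norm_num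
    have := h0 (i = j)
    have := h0 (i = k)
    have := h0 (j = k)
    have h1 : adjIndicator (cubeGraph d)
        s(x + Pi.single i 1 + Pi.single j 1 + Pi.single k 1, x) = 1 := by simp [adjIndicator, h]
    rw [h1]
    rcases hor with h | h | h <;> simp only [h, if_true] at * <;> linarith
  · have h1 : adjIndicator (cubeGraph d)
        s(x + Pi.single i 1 + Pi.single j 1 + Pi.single k 1, x) = 0 := by simp [adjIndicator, h]
    rw [h1]
    positivity

theorem isCycleKernel_cubeGraph (d : ℕ) :
    IsCycleKernel (adjIndicator (cubeGraph d)) (d / 2 ^ d) 1 0 (3 * d ^ 2 / (2 ^ d) ^ 3) where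
  nonneg e := by unfold adjIndicator; split_ifs <;> norm_num
  le e := by unfold adjIndicator; split_ifs <;> norm_num
  le_one := le_rfl
  row x := by
    have := sum_adjIndicator_cubeGraph_mul x fun _ => 1
    simp only [mul_one, Finset.sum_const, Finset.card_univ, Fintype.card_fin, nsmul_eq_mul] at this
    rw [this]
    simp
    field_simp
  triangle x := by
    rw [mul_zero]
    refine Finset.sum_eq_zero fun y _ => Finset.sum_eq_zero fun z _ => ?_
    by_cases h1 : (cubeGraph d).Adj x y
    · by_cases h2 : (cubeGraph d).Adj y z
      · have h3 : ¬ (cubeGraph d).Adj z x := fun h3 => not_cubeGraph_triangle h1 h2 h3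
        simp [adjIndicator, h3]
      · simp [adjIndicator, h2]
    · simp [adjIndicator, h1]
  square x := by
    simp only [mul_assoc, ← Finset.mul_sum, sum_adjIndicator_cubeGraph_mul]
    calc _ ≤ ∑ i : Fin d, ∑ j : Fin d, ∑ k : Fin d, (((if i = j then 1 else 0) +
          (if i = k then 1 else 0) + (if j = k then 1 else 0) : ℝ)) :=
          Finset.sum_le_sum fun i _ => Finset.sum_le_sum fun j _ => Finset.sum_le_sum fun k _ =>
            adjIndicator_cubeGraph_add_le x i j k
      _ = 3 * d ^ 2 := by
        simp [Finset.sum_add_distrib]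
        ring
      _ = _ := by
        simp
        field_simp

/-! ### Removing loops by colouring -/

/-- The graph on `W × ι` in which `(x, i)` and `(y, j)` are adjacent when `x` and `y` are not
adjacent in `K` and `i ≠ j`. -/
def coloredComplement {W : Type*} (K : SimpleGraph W) (ι : Type*) : SimpleGraph (W × ι) where
  Adj p q := ¬ K.Adj p.1 q.1 ∧ p.2 ≠ q.2
  symm := ⟨fun _ _ h => ⟨fun h' => h.1 h'.symm, h.2.symm⟩⟩
  loopless := ⟨fun _ h => h.2 rfl⟩

open Classical in
/-- The looped complement of a graph, as a weighted graph with uniform vertex weights of sum one. -/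
noncomputable def loopedComplement {W : Type*} [Fintype W] (K : SimpleGraph W) :
    FinWeightedGraph W where
  vertexWeight _ := (Fintype.card W : ℝ≥0)⁻¹
  edgeWeight x y := if K.Adj x y then 0 else 1
  symm x y := by simp only [K.adj_comm]

section Count

variable {V W : Type*} [Fintype V] [Fintype W] [DecidableEq V] (F : SimpleGraph V)
  (K : SimpleGraph W)

theorem weightedHom_loopedComplement_eq_edgeDensity [Fintype F.edgeSet] :
    weightedHom F (loopedComplement K) =
      edgeDensity F.edgeFinset (fun e => 1 + -1 * adjIndicator K e) := by
  have h : ∀ e, ((loopedComplement K).pairWeight e : ℝ) = 1 + -1 * adjIndicator K e := by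
    intro e
    induction e with | _ x y
    by_cases hxy : K.Adj x y <;>
      simp [FinWeightedGraph.pairWeight, loopedComplement, adjIndicator, hxy]
  unfold weightedHom edgeDensity
  simp only [h]
  simp only [loopedComplement, Finset.prod_const, Finset.card_univ]
  rw [← Finset.mul_sum, mul_comm, div_eq_mul_inv]
  congr 1
  · congr!
  · simp

theorem card_pow_mul_weightedHom_loopedComplement [Nonempty W] :
    (Fintype.card W : ℝ) ^ Fintype.card V * weightedHom F (loopedComplement K) =
      Nat.card {x : V → W // ∀ u v, F.Adj u v → ¬ K.Adj (x u) (x v)} := by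
  classical
  have h : ∀ x : V → W, ∏ e ∈ F.edgeFinset, (1 + -1 * adjIndicator K (e.map x)) =
      if ∀ u v, F.Adj u v → ¬ K.Adj (x u) (x v) then 1 else 0 := by
    intro x
    split_ifs with hx
    · refine Finset.prod_eq_one fun e he => ?_
      induction e with | _ u v
      have := hx u v (by simpa using he)
      simp [adjIndicator, this]
    · push Not at hx
      obtain ⟨u, v, huv, hK⟩ := hx
      refine Finset.prod_eq_zero (i := s(u, v)) (by simpa using huv) ?_
      simp [adjIndicator, hK]
  rw [weightedHom_loopedComplement_eq_edgeDensity, edgeDensity, mul_div_cancel₀ _ (by simp)]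
  simp only [h, Finset.sum_boole, Nat.card_eq_fintype_card, Fintype.card_subtype]

/-- Forget that the colours of adjacent vertices must differ. -/
theorem homCount_coloredComplement_le [Nonempty W] (q : ℕ) :
    (homCount F (coloredComplement K (Fin q)) : ℝ) ≤
      ((Fintype.card W * q : ℕ) : ℝ) ^ Fintype.card V * weightedHom F (loopedComplement K) := by
  rw [Nat.cast_mul, mul_pow, mul_right_comm, card_pow_mul_weightedHom_loopedComplement]
  have h : homCount F (coloredComplement K (Fin q)) ≤
      Nat.card ({x : V → W // ∀ u v, F.Adj u v → ¬ K.Adj (x u) (x v)} × (V → Fin q)) := by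
    refine Nat.card_le_card_of_injective
      (fun f => (⟨fun v => (f v).1, fun u v huv => (f.map_adj huv).1⟩, fun v => (f v).2)) ?_
    intro f g hfg
    simp only [Prod.mk.injEq, Subtype.mk.injEq] at hfg
    ext v
    · exact congrFun hfg.1 v
    · exact congrArg Fin.val (congrFun hfg.2 v)
  rw [Nat.card_prod] at h
  have h' : Nat.card (V → Fin q) = q ^ Fintype.card V := by simp
  rw [h'] at h
  exact_mod_cast h

/-- Injective colourings are always admissible. -/
theorem le_homCount_coloredComplement [Nonempty W] (q : ℕ) :
    (Fintype.card W : ℝ) ^ Fintype.card V * weightedHom F (loopedComplement K) *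
      (q.descFactorial (Fintype.card V) : ℝ) ≤ homCount F (coloredComplement K (Fin q)) := by
  rw [card_pow_mul_weightedHom_loopedComplement]
  have h : Nat.card ({x : V → W // ∀ u v, F.Adj u v → ¬ K.Adj (x u) (x v)} × (V ↪ Fin q)) ≤
      homCount F (coloredComplement K (Fin q)) := by
    refine Nat.card_le_card_of_injective (fun p => (⟨fun v => (p.1.1 v, p.2 v), fun {u v} huv =>
      ⟨p.1.2 u v huv, fun h => huv.ne (p.2.injective h)⟩⟩ : F →g coloredComplement K (Fin q))) ?_
    rintro ⟨⟨x, hx⟩, i⟩ ⟨⟨y, hy⟩, j⟩ h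
    have h' : ∀ v, (x v, i v) = (y v, j v) := fun v => DFunLike.congr_fun h v
    simp only [Prod.mk.injEq] at h'
    ext v
    · exact (h' v).1
    · exact congrArg Fin.val (h' v).2
  rw [Nat.card_prod] at h
  have h' : Nat.card (V ↪ Fin q) = q.descFactorial (Fintype.card V) := by
    rw [Nat.card_eq_fintype_card, Fintype.card_embedding_eq, Fintype.card_fin]
  rw [h'] at h
  exact_mod_cast h

end Count

open Classical in
-- Each non-isolated vertex receives `1 / d_v` from each of its `d_v` edges; an isolated one
-- receives nothing.
theorem sum_sum_inv_degree_le {V : Type*} [Fintype V] (G : SimpleGraph V) :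
    ∑ e ∈ G.edgeFinset, ∑ v, (if v ∈ e then ((G.degree v : ℝ))⁻¹ else 0) ≤ Fintype.card V := by
  rw [Finset.sum_comm]
  refine (Finset.sum_le_sum (g := fun _ => (1 : ℝ)) fun v _ => ?_).trans_eq (by simp)
  rw [← Finset.sum_filter, ← SimpleGraph.incidenceFinset_eq_filter, Finset.sum_const,
    SimpleGraph.card_incidenceFinset_eq_degree, nsmul_eq_mul]
  exact mul_inv_le_one

/-- The normalizing factor of `K_{a,b}` is `X ^ (a + b)`, whose root has exponent `1 / a + 1 / b`.
Over all edges these exponents sum to at most the number of vertices, which suffices because `X ≥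
1`. -/
theorem bicliqueProd_coloredComplement_le {V W : Type*} [Fintype V] [Fintype W] [Nonempty W]
    (G : SimpleGraph V) (K : SimpleGraph W) {q : ℕ} (hq : 0 < q) :
    bicliqueProd G (coloredComplement K (Fin q)) ≤
      ((Fintype.card W * q : ℕ) : ℝ) ^ Fintype.card V *
        weightedBicliqueProd G (loopedComplement K) := by
  classical
  set X : ℝ := ((Fintype.card W * q : ℕ) : ℝ) with hX
  have hX1 : 1 ≤ X := by
    rw [hX]
    exact_mod_cast Nat.mul_pos Fintype.card_pos hq
  have hX0 : 0 < X := by linarith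
  have hw0 : 0 ≤ weightedBicliqueProd G (loopedComplement K) := by
    refine Finset.prod_nonneg fun e _ => ?_
    induction e with | _ u v
    exact Real.rpow_nonneg (weightedHom_nonneg _ _) _
  have key : bicliqueProd G (coloredComplement K (Fin q)) ≤
      (∏ e ∈ G.edgeFinset, X ^ (∑ v, (if v ∈ e then ((G.degree v : ℝ))⁻¹ else 0))) *
        weightedBicliqueProd G (loopedComplement K) := by
    unfold bicliqueProd weightedBicliqueProd
    rw [← Finset.prod_mul_distrib]
    refine Finset.prod_le_prod (fun e _ => ?_) fun e he => ?_
    · induction e with | _ u v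
      exact Real.rpow_nonneg (Nat.cast_nonneg _) _
    · induction e with | _ u v
      have huv : G.Adj u v := by simpa using he
      have hu : (0 : ℝ) < G.degree u := by
        exact_mod_cast (G.degree_pos_iff_exists_adj u).2 ⟨v, huv⟩
      have hv : (0 : ℝ) < G.degree v := by
        exact_mod_cast (G.degree_pos_iff_exists_adj v).2 ⟨u, huv.symm⟩
      change (homCount (biclique (G.degree u) (G.degree v)) (coloredComplement K (Fin q)) : ℝ) ^
        (1 / ((G.degree u : ℝ) * (G.degree v : ℝ))) ≤ _ *
        weightedHom (biclique (G.degree u) (G.degree v)) (loopedComplement K) ^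
          (1 / ((G.degree u : ℝ) * (G.degree v : ℝ)))
      have hs : ∑ w, (if w ∈ s(u, v) then ((G.degree w : ℝ))⁻¹ else 0) =
          ((G.degree u + G.degree v : ℕ) : ℝ) * (1 / ((G.degree u : ℝ) * (G.degree v : ℝ))) := by
        rw [← Finset.sum_filter]
        have : univ.filter (fun w => w ∈ s(u, v)) = {u, v} := by ext; simp
        rw [this, Finset.sum_pair huv.ne]
        push_cast
        field_simp
        ring
      rw [hs, Real.rpow_mul hX0.le, Real.rpow_natCast,
        ← Real.mul_rpow (by positivity) (weightedHom_nonneg _ _)]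
      refine Real.rpow_le_rpow (Nat.cast_nonneg _) ?_ (by positivity)
      simpa [hX] using homCount_coloredComplement_le (biclique (G.degree u) (G.degree v)) K q
  refine key.trans (mul_le_mul_of_nonneg_right ?_ hw0)
  rw [← Real.rpow_sum_of_pos hX0, ← Real.rpow_natCast]
  exact Real.rpow_le_rpow_of_exponent_le hX1 (sum_sum_inv_degree_le G)

theorem homCount_congr_right {V W W' : Type*} (F : SimpleGraph V) {H : SimpleGraph W}
    {H' : SimpleGraph W'} (f : H ≃g H') : homCount F H = homCount F H' :=
  Nat.card_congr
    { toFun := fun g => f.toHom.comp g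
      invFun := fun g => f.symm.toHom.comp g
      left_inv := fun g => by ext; simp
      right_inv := fun g => by ext; simp }

theorem bicliqueProd_congr_right {V W W' : Type*} [Fintype V] (G : SimpleGraph V)
    {H : SimpleGraph W} {H' : SimpleGraph W'} (f : H ≃g H') :
    bicliqueProd G H = bicliqueProd G H' := by
  unfold bicliqueProd
  simp only [homCount_congr_right _ f]

/-! ### Choice of parameters and conclusion -/

theorem exists_descFactorial_gt {a b : ℝ} (hab : a < b) (k : ℕ) :
    ∃ q : ℕ, 0 < q ∧ a * (q : ℝ) ^ k < b * q.descFactorial k := by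
  have h : Filter.Tendsto (fun q : ℕ => b * ((q.descFactorial k : ℝ) / (q : ℝ) ^ k)) Filter.atTop
      (nhds (b * 1)) := by
    refine Filter.Tendsto.const_mul b ?_
    have h0 : ∀ᶠ q : ℕ in Filter.atTop, (q : ℝ) ^ k ≠ 0 := by
      filter_upwards [Filter.eventually_gt_atTop 0] with q hq
      positivity
    exact (Asymptotics.isEquivalent_iff_tendsto_one h0).1 (isEquivalent_descFactorial k)
  rw [mul_one] at h
  obtain ⟨q, hq, hq0⟩ := ((h.eventually_const_lt hab).and (Filter.eventually_gt_atTop 0)).exists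
  refine ⟨q, hq0, ?_⟩
  rwa [← mul_div_assoc, lt_div_iff₀ (by positivity)] at hq

theorem sq_le_two_pow {d : ℕ} (hd : 4 ≤ d) : d ^ 2 ≤ 2 ^ d := by
  induction d, hd using Nat.le_induction with
  | base => norm_num
  | succ n hn ih => rw [pow_succ 2 n]; nlinarith

theorem exists_weightedBicliqueProd_lt {V : Type*} [Fintype V] (G : SimpleGraph V)
    (hG : ¬ G.CliqueFree 3) : ∃ d : ℕ, weightedBicliqueProd G (loopedComplement (cubeGraph d)) <
      weightedHom G (loopedComplement (cubeGraph d)) := by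
  classical
  obtain ⟨C, hC, h⟩ := exists_forall_prod_lt_edgeDensity G hG
  obtain ⟨d, hd⟩ := exists_nat_gt (max 4 (6 * C))
  obtain ⟨hd4, hdC⟩ := max_lt_iff.1 hd
  have hd4' : 4 ≤ d := by exact_mod_cast hd4.le
  refine ⟨d, ?_⟩
  have hsq' : (d : ℝ) ^ 2 ≤ 2 ^ d := by exact_mod_cast sq_le_two_pow hd4'
  have hd0 : (0 : ℝ) < d := by linarith
  set β : ℝ := d / 2 ^ d with hβ
  have hβ0 : 0 < β := by positivity
  have hβd : β ≤ 1 / d := by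
    rw [hβ, div_le_div_iff₀ (by positivity) hd0]
    linarith
  have hd14 : 1 / (d : ℝ) ≤ 1 / 4 := one_div_le_one_div_of_le (by norm_num) hd4.le
  have h4 : β ^ 4 ≤ β ^ 3 * (1 / d) := by
    rw [pow_succ]
    gcongr
  have h3 : 0 < β ^ 3 * (1 / d) := by positivity
  rw [weightedHom_loopedComplement_eq_edgeDensity]
  -- With `κ = 0` and `σ = -1` the gain is exactly `β ^ 3`. Both `β ^ 4 ≤ β ^ 3 / d` and `ζ = 3 * β
  -- ^ 3 / d` fit into `η = 6 * β ^ 3 / d`, and `d > 6 * C` gives `C * η < δ`.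
  refine h _ _ β 1 0 (3 * d ^ 2 / (2 ^ d) ^ 3) (-1) (β ^ 3) (6 * (β ^ 3 * (1 / d)))
    (isCycleKernel_cubeGraph d) (by simp) hβ0.le (by linarith) ?_ (by linarith) (by linarith) ?_
    (by positivity) (pow_le_one₀ hβ0.le (by linarith)) (le_of_eq (by ring)) ?_ _ ?_ ?_
  · rw [zero_sub, abs_neg, abs_of_pos (by positivity)]
    linarith
  · have : 3 * (d : ℝ) ^ 2 / (2 ^ d) ^ 3 = 3 * (β ^ 3 * (1 / d)) := by
      rw [hβ]
      field_simp
    linarith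
  · have : C * (6 * (β ^ 3 * (1 / d))) = β ^ 3 * (6 * C / d) := by ring
    rw [this]
    exact mul_lt_of_lt_one_right (by positivity) ((div_lt_one hd0).2 hdC)
  · intro e
    induction e with | _ u v
    exact Real.rpow_nonneg (weightedHom_nonneg _ _) _
  · intro u v _
    change weightedHom (biclique (G.degree u) (G.degree v)) (loopedComplement (cubeGraph d)) ^
      (1 / ((G.degree u : ℝ) * (G.degree v : ℝ))) ≤ _
    rw [weightedHom_loopedComplement_eq_edgeDensity]

theorem exists_bicliqueProd_lt {V : Type*} [Fintype V] (G : SimpleGraph V)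
    (hG : ¬ G.CliqueFree 3) :
    ∃ (n : ℕ) (H : SimpleGraph (Fin n)), bicliqueProd G H < (homCount G H : ℝ) := by
  classical
  obtain ⟨d, hd⟩ := exists_weightedBicliqueProd_lt G hG
  obtain ⟨q, hq, hlt⟩ := exists_descFactorial_gt hd (Fintype.card V)
  set W := Fin d → ZMod 2
  let K : SimpleGraph (W × Fin q) := coloredComplement (cubeGraph d) (Fin q)
  let f := SimpleGraph.Iso.map (Fintype.equivFin (W × Fin q)) K
  refine ⟨Fintype.card (W × Fin q), K.map (Fintype.equivFin (W × Fin q)), ?_⟩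
  rw [← bicliqueProd_congr_right G f, ← homCount_congr_right G f]
  refine (bicliqueProd_coloredComplement_le G (cubeGraph d) hq).trans_lt
    (lt_of_lt_of_le ?_ (le_homCount_coloredComplement G (cubeGraph d) q))
  have hn : (0 : ℝ) < (Fintype.card W : ℝ) ^ Fintype.card V := by
    have : 0 < Fintype.card W := Fintype.card_pos
    positivity
  have := mul_lt_mul_of_pos_left hlt hn
  rw [Nat.cast_mul, mul_pow]
  linarith

theorem mainTheorem9 {V : Type*} [Fintype V] (G : SimpleGraph V) (hG : ¬ G.CliqueFree 3) :
    (∃ (n : ℕ) (H : SimpleGraph (Fin n)), (homCount G H : ℝ) > bicliqueProd G H) ∧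
    (∃ ε₀ : ℝ≥0, 0 < ε₀ ∧ ∀ ε : ℝ≥0, 0 < ε → ε < ε₀ →
      weightedHom G (twoVertexGraph ε) > weightedBicliqueProd G (twoVertexGraph ε)) :=
  ⟨exists_bicliqueProd_lt G hG, exists_forall_weightedBicliqueProd_lt G hG⟩
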